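/- Let $G$ be a finite connected graph, possibly with loops and multiple edges. For a vertex $v$, let $d_G(v)$ be its degree (a loop counts twice), and for a set $X$ of vertices let $d_G(X)$ be the number of edges of $G$ with exactly one end in $X$. Let $f:V(G)\to \mathbb{Z}_2$ be a mapping with $\sum_{v\in V(G)}f(v)\equiv 0 \pmod 2$, and let $\varepsilon$ be a real number with $0<\varepsilon<1$. Suppose that every nonempty proper subset $X$ of $V(G)$ satisfies both of the following: - if $\sum_{v\in X}f(v)$ is odd, then $d_G(X)\ge 1/\varepsilon$; - if $\sum_{v\in X}(d_G(v)-f(v))$ is odd, then $d_G(X)\ge 1/(1-\varepsilon)$. Then $G$ has an $f$-parity factor $F$, that is, a spanning subgraph $F$ with $d_F(v)\equiv f(v)\pmod 2$ for every vertex $v$, such that for every vertex $v$, $$\lfloor \varepsilon d_G(v)\rfloor-1\le d_F(v)\le \lceil \varepsilon d_G(v)\rceil+1 .$$ Furthermore, for any given vertex $z$, there is such a factor $F$ that in addition satisfies $d_F(z)\ge \varepsilon d_G(z)$, and there is such a factor $F$ that in addition satisfies $d_F(z)\le \varepsilon d_G(z)$. -/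

import Mathlib

open scoped Graph

namespace Graph

/-- The degree of `v` in a (finite) multigraph: the number of edges incident with `v`,
each loop at `v` being counted twice. -/
noncomputable def degree {α β : Type*} (G : Graph α β) (v : α) : ℕ :=
  (G.incidenceSet v).ncard + (G.loopSet v).ncard

/-- The edge cut of `X`: the edges with exactly one end in `X`. -/
def edgeCut {α β : Type*} (G : Graph α β) (X : Set α) : Set β :=
  {e | ∃ x y, G.IsLink e x y ∧ x ∈ X ∧ y ∉ X}

/-- The number `d_G(X)` of edges with exactly one end in `X`. -/
noncomputable def cutDegree {α β : Type*} (G : Graph α β) (X : Set α) : ℕ :=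
  (G.edgeCut X).ncard

/-- A graph is connected if it has a vertex and any two vertices are joined by a walk. -/
def IsConnected {α β : Type*} (G : Graph α β) : Prop :=
  V(G).Nonempty ∧ ∀ u ∈ V(G), ∀ v ∈ V(G), Relation.ReflTransGen G.Adj u v

/-- `F` is an `f`-parity factor of `G`: a spanning subgraph in which the degree of every vertex `v`
has the parity `f v`. Only the values of `f` on the vertices of `G` matter. -/
def IsParityFactor {α β : Type*} (F G : Graph α β) (f : α → ZMod 2) : Prop :=
  F ≤s G ∧ ∀ v ∈ V(G), (F.degree v : ZMod 2) = f v

end Graph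

/-!
The constant weight `ε` on the edges behaves like a fractional `f`-parity factor with degrees
`ε * d_G(v)`. The hypothesis on cuts says exactly that this fractional point satisfies the
odd-cut inequalities: if `A` and `S` partition the edge cut of `Y` and the sum of `f` over `Y` plus
`|S|` is odd, then `ε * |A| + (1 - ε) * |S| ≥ 1` (`one_le_cut_weight`). It is rounded to an
honest factor by Tutte's theorem.

*Exact degrees.* Choose for each `v` an integer `n v` of the right parity with
`⌈ε * d_G(v)⌉ ≤ n v ≤ ⌈ε * d_G(v)⌉ + 1`, and put an additional loop of weight
`(n v - ε * d_G(v)) / 2` at `v`. The weighted degree of `v` is now the integer `n v`, and cuts have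
not changed. A factor of the extended graph with degrees exactly `n v` gives a factor of `G` with
degrees `n v` or `n v - 2`, which is within the required bounds, since loops of weight `0` are
never used. At the vertex `z` the loop gets weight `0`, which forces the degree `n z ≥ ε * d_G(z)`;
the price is a defect `n z - ε * d_G(z) < 2`. The bound from above at `z` follows by passing to
the complementary factor, which exchanges `ε` with `1 - ε` and `f` with `d_G - f`.

*Perfect matchings.* A factor with prescribed degrees is a perfect matching of a simple graph
(`FactorGadget.graph`): its vertices are the half-edges and, at each `v`, as many core vertices as
there should be half-edges at `v` outside the factor; the two halves of an edge are adjacent, and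
each core vertex is adjacent to all half-edges at its vertex. The edge weights, together with
`(1 - x) / k v` between a core vertex and a half-edge of an edge of weight `x`, form a
fractional perfect matching, and *every* odd set of vertices has cut weight at least `1`: either it
separates two cores of some vertex (`FactorGadget.one_le_cut_of_mem_of_notMem`), or it comes
from a set `Y` of vertices of the multigraph, and the odd-cut inequalities apply
(`FactorGadget.one_le_cut_of_saturated`).

*Tutte's condition.* If every odd set has cut weight at least `1`, then after deleting `U` each
odd component sends weight at least `1` to `U`, so the number of odd components is at most the
weighted degree of `U`, which is less than `|U| + 2`. By parity it is at most `|U|`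
(`SimpleGraph.exists_isPerfectMatching_of_weight`). This parity gap absorbs the defect at `z`.
-/

/-! ### Perfect matchings from fractional perfect matchings -/

/-- A graph of even order has a perfect matching if it carries a nonnegative weight for which
every odd set of vertices has cut weight at least `1`, and the weighted degrees exceed `1` by less
than `2` in total on every set. -/
theorem SimpleGraph.exists_isPerfectMatching_of_weight {W : Type*} [Fintype W] [DecidableEq W]
    (H : SimpleGraph W) (w : W → W → ℝ) (hw : ∀ p q, 0 ≤ w p q)
    (hadj : ∀ p q, w p q ≠ 0 → H.Adj p q)
    (hodd : ∀ C : Finset W, Odd C.card → 1 ≤ ∑ p ∈ C, ∑ q ∈ Cᶜ, w p q)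
    (hdeg : ∀ U : Finset W, ∑ q ∈ U, ∑ p, w p q < U.card + 2)
    (heven : Even (Fintype.card W)) :
    ∃ M : H.Subgraph, M.IsPerfectMatching := by
  classical
  refine SimpleGraph.tutte.mpr fun u hu ↦ ?_
  unfold SimpleGraph.IsTutteViolator at hu
  set K := ((⊤ : H.Subgraph).deleteVerts u).coe with hK
  let C : K.ConnectedComponent → Finset W :=
    fun c ↦ c.supp.toFinset.map (Function.Embedding.subtype _)
  have hdisj : Set.PairwiseDisjoint (Set.univ : Set K.ConnectedComponent) C := by
    intro c _ c' _ hne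
    refine Finset.disjoint_left.mpr fun p hp hp' ↦ hne ?_
    obtain ⟨a, ha, rfl⟩ := Finset.mem_map.mp hp
    obtain ⟨a', ha', h⟩ := Finset.mem_map.mp hp'
    obtain rfl : a' = a := Subtype.ext h
    rw [Set.mem_toFinset, SimpleGraph.ConnectedComponent.mem_supp_iff] at ha ha'
    exact ha.symm.trans ha'
  -- the weight leaving a component goes to `u`
  have hout : ∀ c ∈ K.oddComponents.toFinset, 1 ≤ ∑ p ∈ C c, ∑ q ∈ u.toFinset, w p q := by
    intro c hc
    refine (hodd (C c) ?_).trans (Finset.sum_le_sum fun p hp ↦ ?_)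
    · rw [Finset.card_map, ← Set.ncard_eq_toFinset_card']
      have h : c ∈ K.oddComponents := Set.mem_toFinset.mp hc
      exact h
    · rw [← Finset.sum_subset (Finset.inter_subset_left (s₁ := (C c)ᶜ) (s₂ := u.toFinset))]
      · exact Finset.sum_le_sum_of_subset_of_nonneg Finset.inter_subset_right fun q _ _ ↦ hw p q
      · intro q hq hqu
        by_contra hne
        have hqu' : q ∉ u := fun h ↦ hqu (Finset.mem_inter.mpr ⟨hq, Set.mem_toFinset.mpr h⟩)
        obtain ⟨a, ha, rfl⟩ := Finset.mem_map.mp hp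
        refine Finset.mem_compl.mp hq (Finset.mem_map.mpr ⟨⟨q, trivial, hqu'⟩, ?_, rfl⟩)
        rw [Set.mem_toFinset, SimpleGraph.ConnectedComponent.mem_supp_iff] at ha ⊢
        rw [← ha]
        refine SimpleGraph.ConnectedComponent.sound (SimpleGraph.Adj.reachable ?_)
        simp only [hK, SimpleGraph.Subgraph.coe_adj, SimpleGraph.Subgraph.deleteVerts_adj]
        exact ⟨trivial, hqu', trivial, a.2.2, (hadj _ _ hne).symm⟩
  have hsum : (K.oddComponents.ncard : ℝ) ≤ ∑ q ∈ u.toFinset, ∑ p, w p q := by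
    calc (K.oddComponents.ncard : ℝ) = ∑ c ∈ K.oddComponents.toFinset, (1 : ℝ) := by
          rw [Set.ncard_eq_toFinset_card']; simp
      _ ≤ ∑ c ∈ K.oddComponents.toFinset, ∑ p ∈ C c, ∑ q ∈ u.toFinset, w p q :=
          Finset.sum_le_sum hout
      _ = ∑ p ∈ K.oddComponents.toFinset.biUnion C, ∑ q ∈ u.toFinset, w p q :=
          (Finset.sum_biUnion (hdisj.subset (Set.subset_univ _))).symm
      _ ≤ ∑ p, ∑ q ∈ u.toFinset, w p q :=
          Finset.sum_le_sum_of_subset_of_nonneg (Finset.subset_univ _)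
            fun p _ _ ↦ Finset.sum_nonneg fun q _ ↦ hw p q
      _ = _ := Finset.sum_comm
  have hlt := hsum.trans_lt (hdeg u.toFinset)
  rw [← Set.ncard_eq_toFinset_card'] at hlt
  have hlt' : K.oddComponents.ncard < u.ncard + 2 := by exact_mod_cast hlt
  -- the two cardinalities have the same parity, as `W` has even order
  have hpar := K.odd_ncard_oddComponents
  have hcard : Nat.card ((⊤ : H.Subgraph).deleteVerts u).verts + u.ncard = Fintype.card W := by
    rw [Nat.card_coe_set_eq, SimpleGraph.Subgraph.deleteVerts_verts, SimpleGraph.Subgraph.verts_top,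
      ← Nat.card_eq_fintype_card, ← Set.ncard_univ]
    exact Set.ncard_sdiff_add_ncard_of_subset (Set.subset_univ u)
  have : K.oddComponents.ncard = u.ncard + 1 := by omega
  rw [this] at hpar
  rw [← hcard] at heven
  grind

/-! ### The gadget graph of a multigraph with prescribed degrees -/

namespace FactorGadget

variable {V B : Type*} [DecidableEq V] [DecidableEq B]

/-- Vertices of the gadget graph of a multigraph with vertices `V` and edges `B`: the half-edges
`(b, i)`, and `k v` core vertices at each `v`. -/
abbrev Vert (B : Type*) {V : Type*} (k : V → ℕ) : Type _ := (B × Bool) ⊕ (Σ v, Fin (k v))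

/-- The fractional perfect matching: weight `x b` between the two halves of `b`, and weight
`(1 - x b) / k v` between each half of `b` ending at `v` and each core vertex at `v`. The map
`vtx b i` gives the end of the half-edge `(b, i)`. -/
noncomputable def weight (vtx : B → Bool → V) (k : V → ℕ) (x : B → ℝ) : Vert B k → Vert B k → ℝ
  | .inl h, .inl h' => if h' = (h.1, !h.2) then x h.1 else 0
  | .inl h, .inr c => if vtx h.1 h.2 = c.1 then (1 - x h.1) / k c.1 else 0
  | .inr c, .inl h => if vtx h.1 h.2 = c.1 then (1 - x h.1) / k c.1 else 0
  | .inr _, .inr _ => 0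

/-- The gadget graph. The halves of an edge of weight `0` are not adjacent, so that such an edge is
never used by a factor. In a perfect matching the edges whose two halves are matched to each other
form the factor, and the remaining half-edges at `v` are matched with the core vertices at `v`. -/
def graph (vtx : B → Bool → V) (k : V → ℕ) (x : B → ℝ) : SimpleGraph (Vert B k) where
  Adj
    | .inl h, .inl h' => h' = (h.1, !h.2) ∧ x h.1 ≠ 0
    | .inl h, .inr c => vtx h.1 h.2 = c.1
    | .inr c, .inl h => vtx h.1 h.2 = c.1
    | .inr _, .inr _ => False
  symm := ⟨by
    rintro (⟨b, i⟩ | c) (⟨b', i'⟩ | c') h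
    · obtain ⟨h1, h2⟩ := h
      obtain ⟨rfl, rfl⟩ := Prod.mk.inj h1
      exact ⟨by simp, h2⟩
    all_goals exact h⟩
  loopless := ⟨by
    rintro (⟨b, i⟩ | c) h
    · have := (Prod.mk.inj h.1).2
      simp at this
    · exact h⟩

variable {vtx : B → Bool → V} {k : V → ℕ} {x : B → ℝ}

lemma weight_nonneg (hx0 : ∀ b, 0 ≤ x b) (hx1 : ∀ b, x b ≤ 1) (p q : Vert B k) :
    0 ≤ weight vtx k x p q := by
  have h1 : ∀ b, 0 ≤ 1 - x b := fun b ↦ sub_nonneg.mpr (hx1 b)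
  rcases p with h | c <;> rcases q with h' | c' <;> simp only [weight]
  · split_ifs <;> simp [hx0]
  · split_ifs
    · exact div_nonneg (h1 _) (Nat.cast_nonneg _)
    · exact le_rfl
  · split_ifs
    · exact div_nonneg (h1 _) (Nat.cast_nonneg _)
    · exact le_rfl
  · exact le_rfl

lemma adj_of_weight_ne_zero (p q : Vert B k) (h : weight vtx k x p q ≠ 0) :
    (graph vtx k x).Adj p q := by
  rcases p with p | c <;> rcases q with q | c' <;> simp only [weight, graph] at h ⊢
  · simpa using h
  · by_contra hne
    exact h (if_neg hne)
  · by_contra hne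
    exact h (if_neg hne)
  · exact h rfl

variable [Fintype V] [Fintype B]

lemma sum_weight_half (hk : ∀ v, 0 < k v) (h : B × Bool) :
    ∑ p, weight vtx k x p (.inl h) = 1 := by
  have hk' : (k (vtx h.1 h.2) : ℝ) ≠ 0 := by exact_mod_cast (hk _).ne'
  rw [Fintype.sum_sum_type, Fintype.sum_sigma]
  have e1 : ∑ p : B × Bool, weight vtx k x (.inl p) (.inl h) = x h.1 := by
    rw [Finset.sum_eq_single (h.1, !h.2)]
    · simp [weight]
    · rintro ⟨b, i⟩ - hne
      refine if_neg fun he ↦ hne ?_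
      subst he
      simp
    · simp
  have e2 : ∑ v, ∑ j : Fin (k v), weight vtx k x (.inr ⟨v, j⟩) (.inl h) = 1 - x h.1 := by
    rw [Finset.sum_eq_single (vtx h.1 h.2)]
    · simp only [weight, if_true]
      simp
      field_simp
    · intro v _ hv
      exact Finset.sum_eq_zero fun j _ ↦ if_neg (Ne.symm hv)
    · simp
  rw [e1, e2]
  ring

lemma sum_weight_core (c : Σ v, Fin (k v)) :
    ∑ p, weight vtx k x p (.inr c) =
      (∑ h : B × Bool with vtx h.1 h.2 = c.1, (1 - x h.1)) / k c.1 := by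
  rw [Fintype.sum_sum_type, Finset.sum_filter, Finset.sum_div]
  simp only [weight, Finset.sum_const_zero, add_zero]
  refine Finset.sum_congr rfl fun h _ ↦ ?_
  split_ifs <;> simp

/-- The fraction of the core vertices at `v` that lie outside `C`. -/
noncomputable def outside (C : Finset (Vert B k)) (v : V) : ℝ :=
  ((Finset.univ.filter fun j : Fin (k v) ↦ (Sum.inr ⟨v, j⟩ : Vert B k) ∉ C).card : ℝ) / k v

/-- The cut weight of a set of gadget vertices, sorted by the edges of the multigraph: the edge
between the two halves, and the edges between each half and the cores. -/
lemma sum_weight_cut (hk : ∀ v, 0 < k v) (C : Finset (Vert B k)) :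
    ∑ p ∈ C, ∑ q ∈ Cᶜ, weight vtx k x p q =
      ∑ b, ((if (.inl (b, true) ∈ C ↔ .inl (b, false) ∈ C) then 0 else x b) +
        ∑ i, (1 - x b) * if .inl (b, i) ∈ C then outside C (vtx b i)
          else 1 - outside C (vtx b i)) := by
  have key : ∀ p q, (if p ∈ C then if q ∈ Cᶜ then weight vtx k x p q else 0 else 0) =
      if p ∈ C ∧ q ∉ C then weight vtx k x p q else 0 := by
    intro p q
    by_cases hp : p ∈ C <;> by_cases hq : q ∈ C <;> simp [hp, hq]
  have h0 : ∑ p ∈ C, ∑ q ∈ Cᶜ, weight vtx k x p q =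
      ∑ p, ∑ q, if p ∈ C ∧ q ∉ C then weight vtx k x p q else 0 := by
    simp only [← key]
    rw [← Finset.sum_subset (Finset.subset_univ C)]
    · refine Finset.sum_congr rfl fun p hp ↦ ?_
      rw [← Finset.sum_subset (Finset.subset_univ Cᶜ)]
      · refine Finset.sum_congr rfl fun q hq ↦ ?_
        rw [if_pos hp, if_pos hq]
      · intro q _ hq
        rw [if_pos hp, if_neg hq]
    · intro p _ hp
      simp [hp]
  rw [h0]
  simp only [Fintype.sum_sum_type, Finset.sum_add_distrib]
  have e1 : ∑ h : B × Bool, ∑ h' : B × Bool,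
      (if (Sum.inl h : Vert B k) ∈ C ∧ (Sum.inl h' : Vert B k) ∉ C
        then weight vtx k x (.inl h) (.inl h') else 0) =
      ∑ b, if (.inl (b, true) ∈ C ↔ .inl (b, false) ∈ C) then 0 else x b := by
    rw [Fintype.sum_prod_type]
    refine Finset.sum_congr rfl fun b _ ↦ ?_
    have : ∀ i, ∑ h' : B × Bool, (if (Sum.inl (b, i) : Vert B k) ∈ C ∧ (Sum.inl h' : Vert B k) ∉ C
        then weight vtx k x (.inl (b, i)) (.inl h') else 0) =
        if (Sum.inl (b, i) : Vert B k) ∈ C ∧ (Sum.inl (b, !i) : Vert B k) ∉ C then x b else 0 := by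
      intro i
      rw [Finset.sum_eq_single (b, !i)]
      · simp [weight]
      · intro h' _ hne
        simp [weight, hne]
      · simp
    simp only [this, Fintype.sum_bool, Bool.not_true, Bool.not_false]
    by_cases h1 : (Sum.inl (b, true) : Vert B k) ∈ C <;>
      by_cases h2 : (Sum.inl (b, false) : Vert B k) ∈ C <;> simp [h1, h2]
  have e2 : ∑ h : B × Bool, ∑ c : (Σ v, Fin (k v)),
      (if (Sum.inl h : Vert B k) ∈ C ∧ (Sum.inr c : Vert B k) ∉ C
        then weight vtx k x (.inl h) (.inr c) else 0) =
      ∑ b, ∑ i, (1 - x b) * if .inl (b, i) ∈ C then outside C (vtx b i) else 0 := by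
    rw [Fintype.sum_prod_type]
    refine Finset.sum_congr rfl fun b _ ↦ Finset.sum_congr rfl fun i _ ↦ ?_
    rw [Fintype.sum_sigma, Finset.sum_eq_single (vtx b i)]
    · by_cases hC : (Sum.inl (b, i) : Vert B k) ∈ C
      · simp only [hC, true_and, weight, if_true, outside]
        rw [← Finset.sum_filter, Finset.sum_const, nsmul_eq_mul]
        ring
      · simp [hC]
    · intro v _ hv
      refine Finset.sum_eq_zero fun j _ ↦ ?_
      simp [weight, hv.symm]
    · simp
  have e3 : ∑ c : (Σ v, Fin (k v)), ∑ h : B × Bool,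
      (if (Sum.inr c : Vert B k) ∈ C ∧ (Sum.inl h : Vert B k) ∉ C
        then weight vtx k x (.inr c) (.inl h) else 0) =
      ∑ b, ∑ i, (1 - x b) * if .inl (b, i) ∈ C then 0 else 1 - outside C (vtx b i) := by
    rw [Finset.sum_comm, Fintype.sum_prod_type]
    refine Finset.sum_congr rfl fun b _ ↦ Finset.sum_congr rfl fun i _ ↦ ?_
    rw [Fintype.sum_sigma, Finset.sum_eq_single (vtx b i)]
    · by_cases hC : (Sum.inl (b, i) : Vert B k) ∈ C
      · simp [hC]
      · simp only [hC, not_false_eq_true, and_true, weight, if_true, if_false, outside]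
        rw [← Finset.sum_filter, Finset.sum_const, nsmul_eq_mul]
        have hk' : (k (vtx b i) : ℝ) ≠ 0 := by exact_mod_cast (hk _).ne'
        have hc := Finset.card_filter_add_card_filter_not
          (s := (Finset.univ : Finset (Fin (k (vtx b i)))))
          (fun j ↦ (Sum.inr ⟨vtx b i, j⟩ : Vert B k) ∈ C)
        rw [Finset.card_univ, Fintype.card_fin] at hc
        have hc' := congrArg (Nat.cast (R := ℝ)) hc
        push_cast at hc'
        rw [eq_sub_of_add_eq hc']
        field_simp
    · intro v _ hv
      refine Finset.sum_eq_zero fun j _ ↦ ?_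
      simp [weight, hv.symm]
    · simp
  have e4 : ∑ c : (Σ v, Fin (k v)), ∑ c' : (Σ v, Fin (k v)),
      (if (Sum.inr c : Vert B k) ∈ C ∧ (Sum.inr c' : Vert B k) ∉ C
        then weight vtx k x (.inr c) (.inr c') else 0) = 0 := by
    simp [weight]
  rw [e1, e2, e3, e4, add_zero, add_assoc]
  congr 1
  rw [← Finset.sum_add_distrib]
  simp only [← Finset.sum_add_distrib, ← mul_add]
  refine Finset.sum_congr rfl fun b _ ↦ Finset.sum_congr rfl fun i _ ↦ ?_
  split_ifs <;> simp

end FactorGadget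

/-! ### Odd cuts of the gadget graph -/

namespace FactorGadget

variable {V B : Type*} [DecidableEq V] [DecidableEq B] [Fintype V] [Fintype B]
variable {vtx : B → Bool → V} {k : V → ℕ} {x : B → ℝ}

/-- If `C` separates two cores `j` and `j'` at `v`, each half-edge at `v` contributes at least
`(1 - x) / k v` to the cut, whichever side it is on: the other side contains `j` or `j'`. These
contributions sum to at least `1`. -/
lemma one_le_cut_of_mem_of_notMem (hx0 : ∀ b, 0 ≤ x b) (hx1 : ∀ b, x b ≤ 1) (hk : ∀ v, 0 < k v)
    (hσ : ∀ v, (k v : ℝ) ≤ ∑ h : B × Bool with vtx h.1 h.2 = v, (1 - x h.1))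
    (C : Finset (Vert B k)) (v : V) (j j' : Fin (k v)) (hj : (.inr ⟨v, j⟩ : Vert B k) ∈ C)
    (hj' : (.inr ⟨v, j'⟩ : Vert B k) ∉ C) :
    1 ≤ ∑ p ∈ C, ∑ q ∈ Cᶜ, weight vtx k x p q := by
  have hkr : (0 : ℝ) < k v := by exact_mod_cast hk v
  have hx1' : ∀ b, 0 ≤ 1 - x b := fun b ↦ sub_nonneg.mpr (hx1 b)
  have hout : ∀ u, 0 ≤ outside C u ∧ outside C u ≤ 1 := by
    intro u
    refine ⟨div_nonneg (Nat.cast_nonneg _) (Nat.cast_nonneg _),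
      div_le_one_of_le₀ ?_ (Nat.cast_nonneg _)⟩
    exact_mod_cast (Finset.card_le_univ _).trans_eq (Fintype.card_fin _)
  have h1 : 1 / (k v : ℝ) ≤ outside C v := by
    unfold outside
    gcongr
    exact_mod_cast Finset.card_pos.mpr ⟨j', by simpa using hj'⟩
  have h2 : 1 / (k v : ℝ) ≤ 1 - outside C v := by
    have : ((Finset.univ.filter fun j : Fin (k v) ↦ (Sum.inr ⟨v, j⟩ : Vert B k) ∉ C).card : ℝ) + 1
        ≤ k v := by
      have := Finset.card_lt_card (s := Finset.univ.filter fun j : Fin (k v) ↦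
        (Sum.inr ⟨v, j⟩ : Vert B k) ∉ C) (t := Finset.univ)
        ((Finset.ssubset_univ_iff).mpr fun h ↦ (Finset.mem_filter.mp (h.symm ▸ Finset.mem_univ j :
          j ∈ Finset.univ.filter fun j ↦ (Sum.inr ⟨v, j⟩ : Vert B k) ∉ C)).2 hj)
      rw [Finset.card_univ, Fintype.card_fin] at this
      exact_mod_cast this
    unfold outside
    rw [le_sub_iff_add_le, ← add_div, div_le_one hkr]
    linarith
  rw [sum_weight_cut hk C]
  calc (1 : ℝ) = k v * (1 / k v) := by field_simp
    _ ≤ (∑ h : B × Bool with vtx h.1 h.2 = v, (1 - x h.1)) * (1 / k v) := by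
        gcongr
        exact hσ v
    _ ≤ ∑ h : B × Bool, (1 - x h.1) * (if .inl (h.1, h.2) ∈ C then outside C (vtx h.1 h.2)
          else 1 - outside C (vtx h.1 h.2)) := by
        rw [Finset.sum_mul, Finset.sum_filter]
        refine Finset.sum_le_sum fun h _ ↦ ?_
        split_ifs with hv hC hC
        · exact mul_le_mul_of_nonneg_left (hv ▸ h1) (hx1' _)
        · exact mul_le_mul_of_nonneg_left (hv ▸ h2) (hx1' _)
        · exact mul_nonneg (hx1' _) (hout _).1
        · exact mul_nonneg (hx1' _) (sub_nonneg.mpr (hout _).2)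
    _ ≤ _ := by
        rw [Fintype.sum_prod_type]
        refine Finset.sum_le_sum fun b _ ↦ le_add_of_nonneg_left ?_
        split_ifs
        exacts [le_rfl, hx0 b]

/-- The odd-cut inequalities for the weight `x`: whenever `S` is a subset of the cut of `Y` such
that the number of half-edges at `Y`, plus the number of cores at `Y`, plus `|S|` is odd, the edges
of `S` with weight `1 - x b` and the other edges of the cut with weight `x b` sum to at least
`1`. -/
def CutCondition (vtx : B → Bool → V) (k : V → ℕ) (x : B → ℝ) : Prop :=
  ∀ (Y : Finset V) (S : Finset B), (∀ b ∈ S, ¬(vtx b true ∈ Y ↔ vtx b false ∈ Y)) →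
    Odd (∑ v ∈ Y, ((Finset.univ.filter fun h : B × Bool ↦ vtx h.1 h.2 = v).card + k v) + S.card) →
    1 ≤ ∑ b with ¬(vtx b true ∈ Y ↔ vtx b false ∈ Y), if b ∈ S then 1 - x b else x b

open scoped Classical in
/-- The contribution of an edge of weight `x` to the cut weight of a set `C` of gadget vertices
that contains, at each vertex of the multigraph, either all cores or none. Here `c i` says that
the `i`-th half is in `C`, and `y i` says that the cores at its end are in `C`. -/
noncomputable def edgeCost (x : ℝ) (c y : Bool → Prop) : ℝ :=
  (if (c true ↔ c false) then 0 else x) +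
    ∑ i, (1 - x) * if c i then (if y i then 0 else 1) else 1 - (if y i then 0 else 1)

lemma edgeCost_bounds {x : ℝ} (hx0 : 0 ≤ x) (hx1 : x ≤ 1) (c y : Bool → Prop) :
    0 ≤ edgeCost x c y ∧ ((y true ↔ y false) → ¬ (c true ↔ c false) → 1 ≤ edgeCost x c y) ∧
      (¬ (y true ↔ y false) → (c true ↔ c false) → 1 - x ≤ edgeCost x c y) ∧
      (¬ (y true ↔ y false) → ¬ (c true ↔ c false) → x ≤ edgeCost x c y) := by
  unfold edgeCost
  rw [Fintype.sum_bool]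
  generalize c true = c1, c false = c2, y true = y1, y false = y2
  by_cases hc1 : c1 <;> by_cases hc2 : c2 <;> by_cases hy1 : y1 <;> by_cases hy2 : y2 <;>
    simp only [hc1, hc2, hy1, hy2, iff_self, if_true, if_false, iff_false, iff_true, not_true,
      not_false_iff, false_imp_iff, true_imp_iff, and_true, true_and] <;>
    (try constructor) <;> linarith

/-- The parity count for one edge: the halves in `C`, the ends in `Y`, and whether the edge counts
for `S`. -/
lemma even_edge (c y : Bool → Prop) [DecidablePred c] [DecidablePred y]
    (h : (y true ↔ y false) → (c true ↔ c false)) :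
    Even ((∑ i, if c i then 1 else 0) + (∑ i, if y i then 1 else 0) +
      if ¬(y true ↔ y false) ∧ (c true ↔ c false) then 1 else 0) := by
  simp only [Fintype.sum_bool]
  by_cases hc1 : c true <;> by_cases hc2 : c false <;> by_cases hy1 : y true <;>
    by_cases hy2 : y false <;>
    simp only [hc1, hc2, hy1, hy2, iff_self, if_true, if_false, iff_false, iff_true, not_true,
      not_false_iff, false_imp_iff, true_imp_iff, and_true, true_and] at h ⊢ <;> decide

/-- If `C` contains at each vertex all cores or none, let `Y` be the set of vertices with cores
in `C`. An edge outside the cut of `Y` with exactly one half in `C` already contributes `1`.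
Otherwise let `S` consist of the edges of the cut of `Y` with both or no halves in `C`: they
contribute `1 - x b`, the other edges of the cut at least `x b`, and as `|C|` is odd the odd-cut
inequality for `Y` and `S` applies. -/
lemma one_le_cut_of_saturated (hx0 : ∀ b, 0 ≤ x b) (hx1 : ∀ b, x b ≤ 1) (hk : ∀ v, 0 < k v)
    (hcut : CutCondition vtx k x) (C : Finset (Vert B k)) (hC : Odd C.card)
    (hsat : ∀ v (j j' : Fin (k v)), (.inr ⟨v, j⟩ : Vert B k) ∈ C → (.inr ⟨v, j'⟩ : Vert B k) ∈ C) :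
    1 ≤ ∑ p ∈ C, ∑ q ∈ Cᶜ, weight vtx k x p q := by
  set Y : Finset V := Finset.univ.filter fun v ↦ (.inr ⟨v, ⟨0, hk v⟩⟩ : Vert B k) ∈ C with hY
  have hmem : ∀ v (j : Fin (k v)), (.inr ⟨v, j⟩ : Vert B k) ∈ C ↔ v ∈ Y := by
    intro v j
    simp only [hY, Finset.mem_filter, Finset.mem_univ, true_and]
    exact ⟨hsat v _ _, hsat v _ _⟩
  have hout : ∀ v, outside C v = if v ∈ Y then 0 else 1 := by
    intro v
    have : (k v : ℝ) ≠ 0 := by exact_mod_cast (hk v).ne'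
    unfold outside
    simp only [hmem]
    split_ifs with h <;> simp [h, this]
  have hg : ∑ p ∈ C, ∑ q ∈ Cᶜ, weight vtx k x p q =
      ∑ b, edgeCost (x b) (fun i ↦ .inl (b, i) ∈ C) (fun i ↦ vtx b i ∈ Y) := by
    rw [sum_weight_cut hk C]
    simp only [edgeCost, hout]
    refine Finset.sum_congr rfl fun b _ ↦ ?_
    congr!
  have hedge := fun b ↦ edgeCost_bounds (hx0 b) (hx1 b) (fun i ↦ (.inl (b, i) : Vert B k) ∈ C)
    (fun i ↦ vtx b i ∈ Y)
  rw [hg]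
  by_cases hsplit : ∃ b, (vtx b true ∈ Y ↔ vtx b false ∈ Y) ∧
      ¬ ((.inl (b, true) : Vert B k) ∈ C ↔ (.inl (b, false) : Vert B k) ∈ C)
  · obtain ⟨b, hb1, hb2⟩ := hsplit
    exact ((hedge b).2.1 hb1 hb2).trans
      (Finset.single_le_sum (fun b _ ↦ (hedge b).1) (Finset.mem_univ b))
  replace hsplit : ∀ b, (vtx b true ∈ Y ↔ vtx b false ∈ Y) →
      ((.inl (b, true) : Vert B k) ∈ C ↔ (.inl (b, false) : Vert B k) ∈ C) :=
    fun b hb ↦ by_contra fun hc ↦ hsplit ⟨b, hb, hc⟩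
  set S : Finset B := Finset.univ.filter fun b ↦ ¬(vtx b true ∈ Y ↔ vtx b false ∈ Y) ∧
    ((.inl (b, true) : Vert B k) ∈ C ↔ (.inl (b, false) : Vert B k) ∈ C) with hS
  refine (hcut Y S (fun b hb ↦ (Finset.mem_filter.mp hb).2.1) ?_).trans ?_
  · have hCcard : C.card = ∑ b : B, ∑ i, (if (.inl (b, i) : Vert B k) ∈ C then 1 else 0)
        + ∑ v ∈ Y, k v := by
      rw [Finset.card_eq_sum_ones, ← Finset.filter_univ_mem C, Finset.sum_filter,
        Fintype.sum_sum_type, Fintype.sum_prod_type, Fintype.sum_sigma]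
      simp only [hmem, Finset.filter_univ_mem]
      congr 1
      rw [← Finset.filter_univ_mem Y, Finset.sum_filter]
      refine Finset.sum_congr rfl fun v _ ↦ ?_
      rw [Finset.sum_const, Finset.card_univ, Fintype.card_fin, smul_eq_mul, mul_ite, mul_one,
        mul_zero, Finset.filter_univ_mem]
    have hD : ∑ v ∈ Y, (Finset.univ.filter fun h : B × Bool ↦ vtx h.1 h.2 = v).card =
        ∑ b : B, ∑ i, if vtx b i ∈ Y then 1 else 0 := by
      rw [← Fintype.sum_prod_type (f := fun h : B × Bool ↦ if vtx h.1 h.2 ∈ Y then 1 else 0),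
        ← Finset.sum_filter, ← Finset.card_eq_sum_ones,
        Finset.card_eq_sum_card_fiberwise (f := fun h : B × Bool ↦ vtx h.1 h.2) (t := Y)]
      · refine Finset.sum_congr rfl fun v hv ↦ ?_
        congr 1
        ext h
        simp only [Finset.mem_filter, Finset.mem_univ, true_and]
        grind
      · intro h hh
        simpa using hh
    have hScard : S.card = ∑ b : B, if ¬(vtx b true ∈ Y ↔ vtx b false ∈ Y) ∧
        ((.inl (b, true) : Vert B k) ∈ C ↔ (.inl (b, false) : Vert B k) ∈ C) then 1 else 0 := by
      rw [hS, Finset.card_filter]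
    have heven : Even (∑ b : B, (∑ i, (if (.inl (b, i) : Vert B k) ∈ C then 1 else 0) +
        ∑ i, (if vtx b i ∈ Y then 1 else 0) + if ¬(vtx b true ∈ Y ↔ vtx b false ∈ Y) ∧
        ((.inl (b, true) : Vert B k) ∈ C ↔ (.inl (b, false) : Vert B k) ∈ C) then 1 else 0)) := by
      exact Finset.even_sum _ fun b _ ↦ even_edge (fun i ↦ (.inl (b, i) : Vert B k) ∈ C)
        (fun i ↦ vtx b i ∈ Y) (hsplit b)
    rw [Finset.sum_add_distrib, Finset.sum_add_distrib, ← hD, ← hScard] at heven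
    rw [Finset.sum_add_distrib]
    rw [hCcard] at hC
    grind
  · rw [Finset.sum_filter]
    refine Finset.sum_le_sum fun b _ ↦ ?_
    split_ifs with hb hbS
    · exact (hedge b).1
    · exact (hedge b).2.2.1 hb (Finset.mem_filter.mp hbS).2.2
    · exact (hedge b).2.2.2 hb fun hc ↦ hbS (Finset.mem_filter.mpr ⟨Finset.mem_univ b, hb, hc⟩)

/-- A multigraph with a weight `x` satisfying the odd-cut inequalities has a set `F` of edges of
nonzero weight such that exactly `k v` half-edges at each `v` are outside `F`, provided that the
weights `1 - x` of the half-edges at `v` sum to at least `k v`, with total excess less than `2`. -/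
theorem exists_factor (hx0 : ∀ b, 0 ≤ x b) (hx1 : ∀ b, x b ≤ 1) (hk : ∀ v, 0 < k v)
    (hσ : ∀ v, (k v : ℝ) ≤ ∑ h : B × Bool with vtx h.1 h.2 = v, (1 - x h.1))
    (hexc : ∑ v, (∑ h : B × Bool with vtx h.1 h.2 = v, (1 - x h.1) - k v) < 2)
    (heven : Even (∑ v, k v)) (hcut : CutCondition vtx k x) :
    ∃ F : Finset B, (∀ b ∈ F, x b ≠ 0) ∧
      ∀ v, (Finset.univ.filter fun h : B × Bool ↦ vtx h.1 h.2 = v ∧ h.1 ∉ F).card = k v := by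
  obtain ⟨M, hM⟩ := (graph vtx k x).exists_isPerfectMatching_of_weight (weight vtx k x)
    (weight_nonneg hx0 hx1) adj_of_weight_ne_zero
    (by
      intro C hC
      by_cases hsat : ∀ v (j j' : Fin (k v)),
        (.inr ⟨v, j⟩ : Vert B k) ∈ C → (.inr ⟨v, j'⟩ : Vert B k) ∈ C
      · exact one_le_cut_of_saturated hx0 hx1 hk hcut C hC hsat
      · push Not at hsat
        obtain ⟨v, j, j', hj, hj'⟩ := hsat
        exact one_le_cut_of_mem_of_notMem hx0 hx1 hk hσ C v j j' hj hj')
    (by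
      intro U
      have hdeg : ∑ q ∈ U, (∑ p, weight vtx k x p q - 1) ≤
          ∑ q, (∑ p, weight vtx k x p q - 1) := by
        refine Finset.sum_le_sum_of_subset_of_nonneg (Finset.subset_univ U) fun q _ _ ↦ ?_
        rcases q with h | c
        · rw [sum_weight_half hk, sub_self]
        · have : (0 : ℝ) < k c.1 := by exact_mod_cast hk c.1
          rw [sum_weight_core, sub_nonneg, one_le_div this]
          exact hσ c.1
      have htot : ∑ q, (∑ p, weight vtx k x p q - 1) =
          ∑ v, (∑ h : B × Bool with vtx h.1 h.2 = v, (1 - x h.1) - k v) := by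
        rw [Fintype.sum_sum_type, Fintype.sum_sigma]
        simp only [sum_weight_half hk, sum_weight_core, sub_self, Finset.sum_const_zero, zero_add]
        refine Finset.sum_congr rfl fun v _ ↦ ?_
        have : (k v : ℝ) ≠ 0 := by exact_mod_cast (hk v).ne'
        rw [Finset.sum_const, Finset.card_univ, Fintype.card_fin, nsmul_eq_mul]
        field_simp
      rw [Finset.sum_sub_distrib, Finset.sum_const, nsmul_eq_mul, mul_one] at hdeg
      linarith)
    (by
      rw [Fintype.card_sum, Fintype.card_prod, Fintype.card_bool, Fintype.card_sigma]
      simp only [Fintype.card_fin]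
      exact (even_two.mul_left _).add heven)
  classical
  have hM' := SimpleGraph.Subgraph.isPerfectMatching_iff.mp hM
  refine ⟨Finset.univ.filter fun b ↦ M.Adj (.inl (b, true)) (.inl (b, false)), ?_, ?_⟩
  · intro b hb
    exact (M.adj_sub (Finset.mem_filter.mp hb).2).2
  intro v
  -- each core at `v` is matched to a half-edge at `v`
  have hcore : ∀ j : Fin (k v), ∃ h : B × Bool, M.Adj (.inr ⟨v, j⟩) (.inl h) := by
    intro j
    obtain ⟨h | c, h', -⟩ := hM' (.inr ⟨v, j⟩)
    · exact ⟨h, h'⟩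
    · exact (M.adj_sub h').elim
  choose m hm using hcore
  have hinj : Function.Injective m := by
    intro j j' h
    have h1 := (hm j).symm
    have h2 := (hm j').symm
    rw [← h] at h2
    have := (hM' _).unique h1 h2
    simpa using this
  have himg : (Finset.univ.filter fun h : B × Bool ↦ vtx h.1 h.2 = v ∧ h.1 ∉
      Finset.univ.filter fun b ↦ M.Adj (.inl (b, true)) (.inl (b, false))) =
      Finset.univ.image m := by
    ext ⟨b, i⟩
    simp only [Finset.mem_filter, Finset.mem_univ, true_and, Finset.mem_image]
    have hF : M.Adj (.inl (b, true)) (.inl (b, false)) → M.Adj (.inl (b, i)) (.inl (b, !i)) := by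
      cases i
      · exact fun h ↦ h.symm
      · exact id
    constructor
    · rintro ⟨rfl, hb⟩
      obtain ⟨h' | ⟨u, j⟩, h, -⟩ := hM' (.inl (b, i))
      · refine absurd ?_ hb
        obtain rfl := (M.adj_sub h).1
        cases i
        · exact h.symm
        · exact h
      · obtain rfl : vtx b i = u := M.adj_sub h
        refine ⟨j, ?_⟩
        simpa using (hM' _).unique (hm j) h.symm
    · rintro ⟨j, hj⟩
      have h := (hj ▸ hm j).symm
      refine ⟨M.adj_sub h, fun hb ↦ ?_⟩
      have := (hM' _).unique h (hF hb)
      simp at this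
  rw [himg, Finset.card_image_of_injective _ hinj, Finset.card_univ, Fintype.card_fin]

end FactorGadget

/-! ### Degrees and cuts in terms of half-edges -/

namespace Graph

/-- The ends of the edges can be chosen in order, which names the half-edges `(e, i)`. -/
lemma exists_ends {α β : Type*} (G : Graph α β) :
    ∃ s : E(G) → Bool → V(G), ∀ e : E(G), G.IsLink e (s e true) (s e false) := by
  have hexs : ∀ e : E(G), ∃ t : Bool → V(G), G.IsLink e (t true) (t false) := by
    rintro ⟨e, he⟩
    obtain ⟨a, b, h⟩ := G.exists_isLink_of_mem_edgeSet he
    exact ⟨fun i ↦ if i then ⟨a, h.left_mem⟩ else ⟨b, h.right_mem⟩, by simpa using h⟩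
  exact ⟨fun e ↦ (hexs e).choose, fun e ↦ (hexs e).choose_spec⟩

variable {α β : Type*} {G : Graph α β} [Fintype E(G)]
  {s : E(G) → Bool → V(G)}

open scoped Classical in
lemma degree_restrict_eq_card (hs : ∀ e : E(G), G.IsLink e (s e true) (s e false)) (P : Set β)
    (v : V(G)) : (G.restrict P).degree v =
      (Finset.univ.filter fun h : E(G) × Bool ↦ s h.1 h.2 = v ∧ (h.1 : β) ∈ P).card := by
  have hinc : ∀ e : E(G), G.Inc e v ↔ s e true = v ∨ s e false = v := by
    intro e
    constructor
    · rintro h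
      rcases h.eq_or_eq_of_isLink (hs e) with h | h
      · exact .inl (Subtype.ext h.symm)
      · exact .inr (Subtype.ext h.symm)
    · rintro (h | h)
      · exact h ▸ (hs e).inc_left
      · exact h ▸ (hs e).inc_right
  have hloop : ∀ e : E(G), G.IsLoopAt e v ↔ s e true = v ∧ s e false = v := by
    intro e
    rw [← isLink_self_iff, (hs e).isLink_iff]
    simp only [Subtype.ext_iff, or_self]
  have e1 : (G.restrict P).incidenceSet v = Subtype.val ''
      {e : E(G) | (s e true = v ∨ s e false = v) ∧ (e : β) ∈ P} := by
    ext e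
    simp only [mem_incidenceSet, restrict_inc, Set.mem_image]
    constructor
    · rintro ⟨h, hP⟩
      exact ⟨⟨e, h.edge_mem⟩, ⟨(hinc ⟨e, h.edge_mem⟩).mp h, hP⟩, rfl⟩
    · rintro ⟨e, ⟨h, hP⟩, rfl⟩
      exact ⟨(hinc e).mpr h, hP⟩
  have e2 : (G.restrict P).loopSet v = Subtype.val ''
      {e : E(G) | (s e true = v ∧ s e false = v) ∧ (e : β) ∈ P} := by
    ext e
    simp only [mem_loopSet, restrict_isLoopAt, Set.mem_image]
    constructor
    · rintro ⟨h, hP⟩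
      exact ⟨⟨e, h.edge_mem⟩, ⟨(hloop ⟨e, h.edge_mem⟩).mp h, hP⟩, rfl⟩
    · rintro ⟨e, ⟨h, hP⟩, rfl⟩
      exact ⟨(hloop e).mpr h, hP⟩
  rw [degree, e1, e2, Set.ncard_image_of_injective _ Subtype.val_injective,
    Set.ncard_image_of_injective _ Subtype.val_injective, Set.ncard_eq_toFinset_card',
    Set.ncard_eq_toFinset_card', Set.toFinset_ofPred, Set.toFinset_ofPred, Finset.card_filter,
    Finset.card_filter, Finset.card_filter, Fintype.sum_prod_type, ← Finset.sum_add_distrib]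
  refine Finset.sum_congr rfl fun e _ ↦ ?_
  rw [Fintype.sum_bool]
  by_cases h1 : s e true = v <;> by_cases h2 : s e false = v <;> by_cases h3 : (e : β) ∈ P <;>
    simp [h1, h2, h3]

open scoped Classical in
lemma degree_eq_card (hs : ∀ e : E(G), G.IsLink e (s e true) (s e false)) (v : V(G)) :
    G.degree v = (Finset.univ.filter fun h : E(G) × Bool ↦ s h.1 h.2 = v).card := by
  have h := degree_restrict_eq_card hs E(G) v
  rw [restrict_self] at h
  simpa using h

open scoped Classical in
lemma cutDegree_eq_card (hs : ∀ e : E(G), G.IsLink e (s e true) (s e false))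
    (Y : Finset V(G)) :
    G.cutDegree (Y.map (Function.Embedding.subtype _) : Finset α) =
      (Finset.univ.filter fun e ↦ ¬(s e true ∈ Y ↔ s e false ∈ Y)).card := by
  have hmem : ∀ v : V(G), (v : α) ∈ ((Y.map (Function.Embedding.subtype _) : Finset α) : Set α) ↔
      v ∈ Y := by simp
  have : G.edgeCut (Y.map (Function.Embedding.subtype _) : Finset α) = Subtype.val ''
      {e : E(G) | ¬(s e true ∈ Y ↔ s e false ∈ Y)} := by
    ext e
    simp only [edgeCut, Set.mem_ofPred_eq, Set.mem_image]
    constructor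
    · rintro ⟨a, b, h, ha, hb⟩
      refine ⟨⟨e, h.edge_mem⟩, ?_, rfl⟩
      rw [← hmem, ← hmem]
      rcases (hs ⟨e, h.edge_mem⟩).isLink_iff.mp h with ⟨h1, h2⟩ | ⟨h1, h2⟩ <;> rw [h1, h2] <;> tauto
    · rintro ⟨e, h, rfl⟩
      rw [← hmem, ← hmem] at h
      by_cases h1 : (s e true : α) ∈ ((Y.map (Function.Embedding.subtype _) : Finset α) : Set α)
      · exact ⟨_, _, hs e, h1, by tauto⟩
      · exact ⟨_, _, (hs e).symm, by tauto, h1⟩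
  rw [cutDegree, this, Set.ncard_image_of_injective _ Subtype.val_injective,
    Set.ncard_eq_toFinset_card', Set.toFinset_ofPred]

lemma degree_restrict_add_degree_restrict_compl
    (hs : ∀ e : E(G), G.IsLink e (s e true) (s e false)) (P : Set β) (v : V(G)) :
    (G.restrict P).degree v + (G.restrict Pᶜ).degree v = G.degree v := by
  classical
  have h := degree_eq_card hs v
  rw [← Finset.card_filter_add_card_filter_not (fun h : E(G) × Bool ↦ (h.1 : β) ∈ P),
    Finset.filter_filter, Finset.filter_filter] at h
  rw [degree_restrict_eq_card hs, degree_restrict_eq_card hs, h]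
  congr!

/-- Modulo `2`, an edge counts in the degree sum over `Y` if and only if it is in the cut of `Y`. -/
lemma sum_degree_eq_cutDegree (hs : ∀ e : E(G), G.IsLink e (s e true) (s e false))
    (Y : Finset V(G)) :
    ∑ v ∈ Y, (G.degree v : ZMod 2) =
      G.cutDegree (Y.map (Function.Embedding.subtype _) : Finset α) := by
  classical
  rw [cutDegree_eq_card hs, Finset.card_filter]
  simp only [degree_eq_card hs, Finset.card_filter, Fintype.sum_prod_type, Fintype.sum_bool]
  push_cast
  rw [Finset.sum_comm]
  refine Finset.sum_congr rfl fun e _ ↦ ?_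
  rw [Finset.sum_add_distrib, Finset.sum_ite_eq, Finset.sum_ite_eq]
  by_cases h1 : s e true ∈ Y <;> by_cases h2 : s e false ∈ Y <;> simp [h1, h2]
  decide

end Graph

/-! ### The cut hypothesis and the rounding of the degrees -/

/-- The odd-cut inequality for the constant weight `ε`, with `t` the sum of `f` over a side of the
cut, and `a` and `w` the numbers of edges counted with `ε` and `1 - ε`. If both are positive, one
edge of each kind suffices; if one is zero, the parity makes one of the hypotheses apply. -/
lemma one_le_cut_weight {ε : ℝ} (hε0 : 0 < ε) (hε1 : ε < 1) {a w : ℕ} {t : ZMod 2}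
    (h1 : t = 1 → 1 / ε ≤ ((a + w : ℕ) : ℝ))
    (h2 : ((a + w : ℕ) : ZMod 2) - t = 1 → 1 / (1 - ε) ≤ ((a + w : ℕ) : ℝ))
    (hodd : t + w = 1) : 1 ≤ ε * a + (1 - ε) * w := by
  have hε1' : 0 < 1 - ε := sub_pos.mpr hε1
  rcases Nat.eq_zero_or_pos w with rfl | hw
  · have := h1 (by simpa using hodd)
    rw [div_le_iff₀ hε0] at this
    simp at this ⊢
    linarith
  rcases Nat.eq_zero_or_pos a with rfl | ha
  · have := h2 (by
      rw [zero_add, ← hodd, CharTwo.sub_eq_add, add_comm])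
    rw [div_le_iff₀ hε1'] at this
    simp at this ⊢
    linarith
  · have ha' : (1 : ℝ) ≤ a := by exact_mod_cast ha
    have hw' : (1 : ℝ) ≤ w := by exact_mod_cast hw
    nlinarith

lemma exists_nat_ceil_parity {r : ℝ} (hr : 0 ≤ r) (t : ZMod 2) :
    ∃ n : ℕ, (n : ZMod 2) = t ∧ ⌈r⌉ ≤ n ∧ (n : ℤ) ≤ ⌈r⌉ + 1 := by
  have hc : (⌈r⌉₊ : ℤ) = ⌈r⌉ := Int.natCast_ceil_eq_ceil hr
  by_cases h : (⌈r⌉₊ : ZMod 2) = t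
  · exact ⟨⌈r⌉₊, h, hc.ge, by omega⟩
  · refine ⟨⌈r⌉₊ + 1, ?_, by omega, by omega⟩
    push_cast
    revert h
    generalize (⌈r⌉₊ : ZMod 2) = u
    revert u t
    decide

/-! ### The factors -/

namespace Graph

variable {α β : Type*}

/-- The factor with the bound from below at `z`, given by its edge set. -/
theorem exists_restrict_ge (G : Graph α β) (hV : V(G).Finite) (hE : E(G).Finite)
    (f : α → ZMod 2) (hf : ∑ v ∈ hV.toFinset, f v = 0)
    (ε : ℝ) (hε0 : 0 < ε) (hε1 : ε < 1)
    (hcut : ∀ X : Finset α, X.Nonempty → (X : Set α) ⊂ V(G) →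
      (∑ v ∈ X, f v = 1 → 1 / ε ≤ (G.cutDegree X : ℝ)) ∧
      (∑ v ∈ X, ((G.degree v : ZMod 2) - f v) = 1 → 1 / (1 - ε) ≤ (G.cutDegree X : ℝ)))
    (z : α) (hz : z ∈ V(G)) :
    ∃ P : Set β, (∀ v ∈ V(G), ((G.restrict P).degree v : ZMod 2) = f v ∧
      ⌊ε * (G.degree v : ℝ)⌋ - 1 ≤ ((G.restrict P).degree v : ℤ) ∧
        ((G.restrict P).degree v : ℤ) ≤ ⌈ε * (G.degree v : ℝ)⌉ + 1) ∧
      ε * (G.degree z : ℝ) ≤ ((G.restrict P).degree z : ℝ) := by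
  classical
  have := hV.fintype
  have := hE.fintype
  obtain ⟨s, hs⟩ := G.exists_ends
  have hnn : ∀ v : V(G), 0 ≤ ε * (G.degree v : ℝ) := fun v ↦
    mul_nonneg hε0.le (Nat.cast_nonneg _)
  choose n hnf hn1 hn2 using fun v : V(G) ↦ exists_nat_ceil_parity (hnn v) (f v)
  have hnr : ∀ v : V(G), ε * (G.degree v : ℝ) ≤ n v := fun v ↦
    (Int.le_ceil _).trans (by exact_mod_cast hn1 v)
  have hnr2 : ∀ v, (n v : ℝ) < ε * (G.degree v : ℝ) + 2 := fun v ↦ by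
    have h1 : (n v : ℝ) ≤ ⌈ε * (G.degree v : ℝ)⌉ + 1 := by exact_mod_cast hn2 v
    have h2 := Int.ceil_lt_add_one (ε * (G.degree v : ℝ))
    linarith
  have hnd : ∀ v : V(G), n v ≤ G.degree v + 1 := fun v ↦ by
    have h1 : ⌈ε * (G.degree v : ℝ)⌉ ≤ G.degree v := by
      rw [Int.ceil_le]
      exact mul_le_of_le_one_left (Nat.cast_nonneg _) hε1.le
    have := hn2 v
    omega
  -- the edges of `G` together with one additional loop at each vertex
  set vtx : E(G) ⊕ V(G) → Bool → V(G) := Sum.elim s fun v _ ↦ v with hvtx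
  set θ : V(G) → ℝ := fun v ↦ if (v : α) = z then 0 else (n v - ε * (G.degree v : ℝ)) / 2 with hθ
  set x : E(G) ⊕ V(G) → ℝ := Sum.elim (fun _ ↦ ε) θ with hx
  -- `n v` is at most `d_G(v) + 1`, so the subtraction is exact and leaves at least one core
  set k : V(G) → ℕ := fun v ↦ G.degree v + 2 - n v with hk
  have hkn : ∀ v, k v + n v = G.degree v + 2 := fun v ↦ by
    have := hnd v
    simp only [hk]
    omega
  have hknr : ∀ v, (k v : ℝ) = G.degree v + 2 - n v := fun v ↦ by
    rw [eq_sub_iff_add_eq]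
    exact_mod_cast hkn v
  have hθ0 : ∀ v, 0 ≤ θ v ∧ θ v ≤ 1 := by
    intro v
    have h1 := hnr v
    have h2 := hnr2 v
    simp only [hθ]
    split_ifs
    · simp
    · constructor <;> linarith
  -- a sum over the half-edges at `v` splits off the two ends of the additional loop
  have hsplit : ∀ (M : Type) [AddCommMonoid M] (g : E(G) ⊕ V(G) → M) (v : V(G)),
      ∑ h : (E(G) ⊕ V(G)) × Bool with vtx h.1 h.2 = v, g h.1 =
        (∑ h : E(G) × Bool with s h.1 h.2 = v, g (.inl h.1)) + 2 • g (.inr v) := by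
    intro M _ g v
    rw [Finset.sum_filter, Finset.sum_filter, Fintype.sum_prod_type, Fintype.sum_prod_type,
      Fintype.sum_sum_type]
    congr 1
    simp only [hvtx, Sum.elim_inr, Fintype.sum_bool]
    rw [Finset.sum_add_distrib, Finset.sum_ite_eq']
    simp [two_nsmul]
  have hσ : ∀ v, ∑ h : (E(G) ⊕ V(G)) × Bool with vtx h.1 h.2 = v, (1 - x h.1) =
      k v + (n v - ε * (G.degree v : ℝ) - 2 * θ v) := by
    intro v
    rw [hsplit ℝ (fun b ↦ 1 - x b) v, hknr]
    simp only [hx, Sum.elim_inl, Sum.elim_inr, Finset.sum_const, ← degree_eq_card hs v]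
    simp only [nsmul_eq_mul]
    push_cast
    ring
  -- the additional loop makes the weighted degree equal to `n v`, except at `z`
  have hexcess : ∀ v, n v - ε * (G.degree v : ℝ) - 2 * θ v =
      if v = ⟨z, hz⟩ then n v - ε * (G.degree v : ℝ) else 0 := by
    intro v
    simp only [hθ, Subtype.ext_iff]
    split_ifs <;> ring
  have hD : ∀ v, (Finset.univ.filter fun h : (E(G) ⊕ V(G)) × Bool ↦ vtx h.1 h.2 = v).card =
      G.degree v + 2 := by
    intro v
    rw [Finset.card_eq_sum_ones, hsplit ℕ (fun _ ↦ 1) v, ← Finset.card_eq_sum_ones,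
      ← degree_eq_card hs v, smul_eq_mul]
  have hkf : ∀ v, (k v : ZMod 2) = G.degree v - f v := by
    intro v
    have h := congrArg (Nat.cast (R := ZMod 2)) (hkn v)
    push_cast at h
    rw [hnf v, show (2 : ZMod 2) = 0 from rfl, add_zero] at h
    exact eq_sub_of_add_eq h
  have huniv : hV.toFinset = Finset.univ.map (Function.Embedding.subtype (· ∈ V(G))) := by
    ext a
    simp
  have hf' : ∑ v : V(G), f v = 0 := by
    rw [huniv, Finset.sum_map] at hf
    exact hf
  have hcut0 : G.cutDegree
      ((Finset.univ : Finset V(G)).map (Function.Embedding.subtype _) : Finset α) = 0 := by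
    rw [cutDegree_eq_card hs]
    simp
  obtain ⟨F, hFx, hF⟩ := FactorGadget.exists_factor (vtx := vtx) (k := k) (x := x)
    (by rintro (e | v); exacts [hε0.le, (hθ0 v).1])
    (by rintro (e | v); exacts [hε1.le, (hθ0 v).2])
    (by
      intro v
      have := hnd v
      have := hkn v
      omega)
    (by
      intro v
      rw [hσ v, hexcess]
      refine le_add_of_nonneg_right ?_
      split_ifs
      · exact sub_nonneg.mpr (hnr v)
      · exact le_rfl)
    (by
      simp only [Finset.sum_sub_distrib, hσ, hexcess, Finset.sum_add_distrib]
      rw [add_sub_cancel_left, Finset.sum_ite_eq', if_pos (Finset.mem_univ _)]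
      have := hnr2 ⟨z, hz⟩
      linarith)
    (by
      rw [← ZMod.natCast_eq_zero_iff_even]
      push_cast
      simp only [hkf]
      rw [Finset.sum_sub_distrib, hf', sum_degree_eq_cutDegree hs, hcut0]
      simp)
    (by
      intro Y S hS hodd
      -- the additional loops are in no cut
      have hxc : ∀ b, ¬(vtx b true ∈ Y ↔ vtx b false ∈ Y) → x b = ε := by
        rintro (e | v) hb
        · rfl
        · exact (hb Iff.rfl).elim
      have hcard : (Finset.univ.filter fun b ↦ ¬(vtx b true ∈ Y ↔ vtx b false ∈ Y)).card =
          G.cutDegree (Y.map (Function.Embedding.subtype _) : Finset α) := by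
        rw [cutDegree_eq_card hs, Finset.card_filter, Finset.card_filter, Fintype.sum_sum_type]
        simp [hvtx]
      set T := Finset.univ.filter fun b ↦ ¬(vtx b true ∈ Y ↔ vtx b false ∈ Y) with hT
      have hST : S ⊆ T := fun b hb ↦ Finset.mem_filter.mpr ⟨Finset.mem_univ b, hS b hb⟩
      have hsum : ∑ b ∈ T, (if b ∈ S then 1 - x b else x b) =
          ε * (T \ S).card + (1 - ε) * S.card := by
        rw [← Finset.sum_sdiff hST]
        congr 1
        · rw [Finset.sum_congr rfl (g := fun _ ↦ ε), Finset.sum_const, nsmul_eq_mul, mul_comm]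
          intro b hb
          obtain ⟨hbT, hbS⟩ := Finset.mem_sdiff.mp hb
          rw [if_neg hbS, hxc b (Finset.mem_filter.mp hbT).2]
        · rw [Finset.sum_congr rfl (g := fun _ ↦ 1 - ε), Finset.sum_const, nsmul_eq_mul, mul_comm]
          intro b hb
          rw [if_pos hb, hxc b (hS b hb)]
      have hadd : (T \ S).card + S.card =
          G.cutDegree (Y.map (Function.Embedding.subtype _) : Finset α) := by
        rw [Finset.card_sdiff_add_card_eq_card hST, hcard]
      have hpar : ∑ v ∈ Y, f v + S.card = 1 := by
        rw [← ZMod.natCast_eq_one_iff_odd] at hodd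
        rw [← hodd]
        push_cast
        congr 1
        refine Finset.sum_congr rfl fun v _ ↦ ?_
        rw [hD, hkf]
        push_cast
        rw [show (2 : ZMod 2) = 0 from rfl, CharTwo.sub_eq_add, add_zero, ← add_assoc,
          CharTwo.add_self_eq_zero, zero_add]
      rw [hsum]
      -- an empty cut would give `∑ v ∈ Y, f v = 1`, which is impossible for `Y = ∅` and `Y = V(G)`
      have hSempty : T.card = 0 → ∑ v ∈ Y, f v = 1 := by
        intro h0
        have : S.card = 0 := Nat.le_zero.mp (h0 ▸ Finset.card_le_card hST)
        simpa [this] using hpar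
      have hne : Y.Nonempty := by
        rw [Finset.nonempty_iff_ne_empty]
        rintro rfl
        have := hSempty (by simp [hT])
        simp at this
      have hproper : Y ≠ Finset.univ := by
        rintro rfl
        have := hSempty (by simp [hT])
        rw [hf'] at this
        simp at this
      have := hcut (Y.map (Function.Embedding.subtype _)) (hne.map) (by
        refine (Set.ssubset_iff_subset_ne).mpr ⟨by
          intro a ha
          obtain ⟨v, -, rfl⟩ := Finset.mem_map.mp ha
          exact v.2, fun h ↦ hproper (Finset.eq_univ_iff_forall.mpr fun v ↦ ?_)⟩
        have hv : (v : α) ∈ ((Y.map (Function.Embedding.subtype _) : Finset α) : Set α) := by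
          rw [h]
          exact v.2
        simpa using hv)
      rw [Finset.sum_map, Finset.sum_map] at this
      refine one_le_cut_weight hε0 hε1 (t := ∑ v ∈ Y, f v) ?_ ?_ hpar
      · rw [hadd]
        exact this.1
      · rw [hadd, ← sum_degree_eq_cutDegree hs, ← Finset.sum_sub_distrib]
        exact this.2)
  set P : Set β := {e | ∃ h : e ∈ E(G), Sum.inl ⟨e, h⟩ ∈ F} with hP
  have hmemP : ∀ e : E(G), (e : β) ∈ P ↔ Sum.inl e ∈ F := fun e ↦
    ⟨fun ⟨_, h⟩ ↦ h, fun h ↦ ⟨e.2, h⟩⟩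
  have hdeg : ∀ v : V(G), (G.restrict P).degree v + (if Sum.inr v ∈ F then 2 else 0) = n v := by
    intro v
    have h1 := hF v
    rw [← Finset.filter_filter, Finset.card_filter,
      hsplit ℕ (fun b ↦ if b ∉ F then 1 else 0) v, ← Finset.card_filter, Finset.filter_filter] at h1
    have h2 := degree_restrict_eq_card hs P v
    simp only [hmemP] at h2
    have h3 := degree_eq_card hs v
    rw [← Finset.card_filter_add_card_filter_not (fun h : E(G) × Bool ↦ Sum.inl h.1 ∈ F),
      Finset.filter_filter, Finset.filter_filter, ← h2] at h3
    have h4 := hkn v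
    split_ifs at h1 ⊢ <;> simp at h1 <;> omega
  refine ⟨P, fun v hv ↦ ?_, ?_⟩
  · have h := hdeg ⟨v, hv⟩
    have h1 := hn1 ⟨v, hv⟩
    have h2 := hn2 ⟨v, hv⟩
    simp only at h h1 h2
    refine ⟨?_, ?_, ?_⟩
    · rw [← hnf ⟨v, hv⟩, ← h]
      split_ifs
      · push_cast
        rw [show (2 : ZMod 2) = 0 from rfl, add_zero]
      · rw [add_zero]
    · -- if the additional loop is used its weight is nonzero, so `n v` exceeds `ε * d_G(v)`
      have h3 := Int.floor_le_ceil (ε * (G.degree v : ℝ))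
      split_ifs at h with hvF
      · have hne := hFx _ hvF
        have hlt : ⌊ε * (G.degree v : ℝ)⌋ + 1 ≤ (n ⟨v, hv⟩ : ℤ) := by
          rw [Int.add_one_le_iff, Int.floor_lt]
          have hlt := lt_of_le_of_ne (hnr ⟨v, hv⟩) (by
            intro he
            refine hne ?_
            simp only [hx, Sum.elim_inr, hθ]
            split_ifs
            · rfl
            · rw [← he, sub_self, zero_div])
          exact_mod_cast hlt
        omega
      · omega
    · omega
  · have h := hdeg ⟨z, hz⟩
    rw [if_neg fun hzF ↦ hFx _ hzF (by simp [hx, hθ])] at h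
    rw [add_zero] at h
    rw [h]
    exact hnr ⟨z, hz⟩

end Graph

namespace Graph

variable {α β : Type*}

/-- The factor with the bound from above at `z`: the complement of the factor that
`exists_restrict_ge` gives for `1 - ε` and `d_G - f`. -/
theorem exists_restrict_le (G : Graph α β) (hV : V(G).Finite) (hE : E(G).Finite)
    (f : α → ZMod 2) (hf : ∑ v ∈ hV.toFinset, f v = 0)
    (ε : ℝ) (hε0 : 0 < ε) (hε1 : ε < 1)
    (hcut : ∀ X : Finset α, X.Nonempty → (X : Set α) ⊂ V(G) →
      (∑ v ∈ X, f v = 1 → 1 / ε ≤ (G.cutDegree X : ℝ)) ∧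
      (∑ v ∈ X, ((G.degree v : ZMod 2) - f v) = 1 → 1 / (1 - ε) ≤ (G.cutDegree X : ℝ)))
    (z : α) (hz : z ∈ V(G)) :
    ∃ P : Set β, (∀ v ∈ V(G), ((G.restrict P).degree v : ZMod 2) = f v ∧
      ⌊ε * (G.degree v : ℝ)⌋ - 1 ≤ ((G.restrict P).degree v : ℤ) ∧
        ((G.restrict P).degree v : ℤ) ≤ ⌈ε * (G.degree v : ℝ)⌉ + 1) ∧
      ((G.restrict P).degree z : ℝ) ≤ ε * (G.degree z : ℝ) := by
  classical
  have := hV.fintype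
  have := hE.fintype
  obtain ⟨s, hs⟩ := G.exists_ends
  have huniv : hV.toFinset = Finset.univ.map (Function.Embedding.subtype (· ∈ V(G))) := by
    ext a
    simp
  have hsum : ∑ v ∈ hV.toFinset, (G.degree v : ZMod 2) = 0 := by
    rw [huniv, Finset.sum_map]
    refine (sum_degree_eq_cutDegree hs Finset.univ).trans ?_
    rw [cutDegree_eq_card hs]
    simp
  obtain ⟨P, hP, hPz⟩ := G.exists_restrict_ge hV hE (fun v ↦ (G.degree v : ZMod 2) - f v)
    (by rw [Finset.sum_sub_distrib, hsum, hf, sub_zero]) (1 - ε) (sub_pos.mpr hε1)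
    (sub_lt_self 1 hε0) (by
      intro X hX hXV
      obtain ⟨h1, h2⟩ := hcut X hX hXV
      refine ⟨h2, ?_⟩
      simpa only [sub_sub_cancel] using h1) z hz
  have hadd : ∀ v ∈ V(G), (G.restrict P).degree v + (G.restrict Pᶜ).degree v = G.degree v :=
    fun v hv ↦ degree_restrict_add_degree_restrict_compl hs P ⟨v, hv⟩
  have heq : ∀ v, (1 - ε) * (G.degree v : ℝ) = G.degree v + -(ε * G.degree v) := fun v ↦ by ring
  refine ⟨Pᶜ, fun v hv ↦ ?_, ?_⟩
  · obtain ⟨h1, h2, h3⟩ := hP v hv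
    have h := hadd v hv
    rw [heq, Int.floor_natCast_add, Int.floor_neg] at h2
    rw [heq, Int.ceil_natCast_add, Int.ceil_neg] at h3
    refine ⟨?_, by omega, by omega⟩
    have hc := congrArg (Nat.cast (R := ZMod 2)) h
    push_cast at hc
    rw [h1] at hc
    linear_combination hc
  · have h : ((G.restrict P).degree z : ℝ) + (G.restrict Pᶜ).degree z = G.degree z := by
      exact_mod_cast hadd z hz
    rw [heq] at hPz
    linarith

lemma restrict_isSpanningSubgraph (G : Graph α β) (P : Set β) : G.restrict P ≤s G where
  vertexSet_eq := rfl
  isLink_mono _ _ _ h := h.2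

end Graph

theorem mainTheorem5 {α β : Type*} (G : Graph α β) (hV : V(G).Finite) (hE : E(G).Finite)
    (hG : G.IsConnected) (f : α → ZMod 2) (hf : ∑ v ∈ hV.toFinset, f v = 0)
    (ε : ℝ) (hε0 : 0 < ε) (hε1 : ε < 1)
    (hcut : ∀ X : Finset α, X.Nonempty → (X : Set α) ⊂ V(G) →
      (∑ v ∈ X, f v = 1 → 1 / ε ≤ (G.cutDegree X : ℝ)) ∧
      (∑ v ∈ X, ((G.degree v : ZMod 2) - f v) = 1 → 1 / (1 - ε) ≤ (G.cutDegree X : ℝ))) :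
    (∃ F : Graph α β, F.IsParityFactor G f ∧
      ∀ v ∈ V(G), ⌊ε * (G.degree v : ℝ)⌋ - 1 ≤ (F.degree v : ℤ) ∧
        (F.degree v : ℤ) ≤ ⌈ε * (G.degree v : ℝ)⌉ + 1) ∧
    ∀ z ∈ V(G),
      (∃ F : Graph α β, F.IsParityFactor G f ∧
        (∀ v ∈ V(G), ⌊ε * (G.degree v : ℝ)⌋ - 1 ≤ (F.degree v : ℤ) ∧
          (F.degree v : ℤ) ≤ ⌈ε * (G.degree v : ℝ)⌉ + 1) ∧
        ε * (G.degree z : ℝ) ≤ (F.degree z : ℝ)) ∧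
      (∃ F : Graph α β, F.IsParityFactor G f ∧
        (∀ v ∈ V(G), ⌊ε * (G.degree v : ℝ)⌋ - 1 ≤ (F.degree v : ℤ) ∧
          (F.degree v : ℤ) ≤ ⌈ε * (G.degree v : ℝ)⌉ + 1) ∧
        (F.degree z : ℝ) ≤ ε * (G.degree z : ℝ)) := by
  have hge := fun z hz ↦ G.exists_restrict_ge hV hE f hf ε hε0 hε1 hcut z hz
  refine ⟨?_, fun z hz ↦ ⟨?_, ?_⟩⟩
  · obtain ⟨z, hz⟩ := hG.1
    obtain ⟨P, hP, -⟩ := hge z hz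
    exact ⟨G.restrict P, ⟨G.restrict_isSpanningSubgraph P, fun v hv ↦ (hP v hv).1⟩,
      fun v hv ↦ (hP v hv).2⟩
  · obtain ⟨P, hP, hPz⟩ := hge z hz
    exact ⟨G.restrict P, ⟨G.restrict_isSpanningSubgraph P, fun v hv ↦ (hP v hv).1⟩,
      fun v hv ↦ (hP v hv).2, hPz⟩
  · obtain ⟨P, hP, hPz⟩ := G.exists_restrict_le hV hE f hf ε hε0 hε1 hcut z hz
    exact ⟨G.restrict P, ⟨G.restrict_isSpanningSubgraph P, fun v hv ↦ (hP v hv).1⟩,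
      fun v hv ↦ (hP v hv).2, hPz⟩
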